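/- For $\epsilon,\epsilon'\in\mathbb{R}$, $\zeta\in\mathbb{C}$ and $\tau\in\mathbb{C}$ with $\operatorname{Im}\tau>0$, let $$\theta\begin{bmatrix}\epsilon\\ \epsilon'\end{bmatrix}(\zeta,\tau)=\sum_{n\in\mathbb{Z}}\exp\left(2\pi i\left[\tfrac12\left(n+\tfrac{\epsilon}{2}\right)^2\tau+\left(n+\tfrac{\epsilon}{2}\right)\left(\zeta+\tfrac{\epsilon'}{2}\right)\right]\right),$$ and let $\theta'\begin{bmatrix}\epsilon\\ \epsilon'\end{bmatrix}(\zeta,\tau)$ denote its derivative with respect to $\zeta$. Then for every $\tau$ with $\operatorname{Im}\tau>0$ the numbers $\theta\begin{bmatrix}1\\ 1/2\end{bmatrix}(0,\tau)$ and $\theta\begin{bmatrix}0\\ 1/2\end{bmatrix}(0,\tau)$ are nonzero, $$\theta'\begin{bmatrix}1\\ 1/2\end{bmatrix}(0,\tau)=\frac14\,\frac{\theta'\begin{bmatrix}1\\ 1\end{bmatrix}(0,\tau)\,\theta\begin{bmatrix}1\\ 0\end{bmatrix}(0,\tau)^3}{\theta\begin{bmatrix}1\\ 1/2\end{bmatrix}(0,\tau)^3}=-\pi\,\theta\begin{bmatrix}0\\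 0\end{bmatrix}(0,2\tau)^2\,\theta\begin{bmatrix}1\\ 1/2\end{bmatrix}(0,\tau)$$ and $$\theta'\begin{bmatrix}0\\ 1/2\end{bmatrix}(0,\tau)=\frac14\,\frac{\theta'\begin{bmatrix}1\\ 1\end{bmatrix}(0,\tau)\,\theta\begin{bmatrix}1\\ 0\end{bmatrix}(0,\tau)^3}{\theta\begin{bmatrix}0\\ 1/2\end{bmatrix}(0,\tau)^3}=-\pi\,\theta\begin{bmatrix}1\\ 0\end{bmatrix}(0,2\tau)^2\,\theta\begin{bmatrix}0\\ 1/2\end{bmatrix}(0,\tau).$$ -/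

import Mathlib

/-- The theta function with real characteristics `ε`, `ε'`,
`∑_{n ∈ ℤ} exp (2πi [½ (n + ε/2)² τ + (n + ε/2) (ζ + ε'/2)])`, for `Im τ > 0`. -/
noncomputable def theta (ε ε' : ℝ) (ζ τ : ℂ) : ℂ :=
  ∑' n : ℤ, Complex.exp (2 * Real.pi * Complex.I *
    (1 / 2 * (n + ε / 2) ^ 2 * τ + (n + ε / 2) * (ζ + ε' / 2)))

/-- The derivative of the theta function with respect to its first variable `ζ`. -/
noncomputable def thetaDeriv (ε ε' : ℝ) (ζ τ : ℂ) : ℂ :=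
  deriv (fun z : ℂ => theta ε ε' z τ) ζ

theorem theta_term_eq (ε ε' : ℝ) (ζ τ : ℂ) (n : ℤ) :
    Complex.exp (2 * Real.pi * Complex.I *
      (1 / 2 * (n + ε / 2) ^ 2 * τ + (n + ε / 2) * (ζ + ε' / 2))) =
    Complex.exp (2 * Real.pi * Complex.I * (ε ^ 2 / 8 * τ + ε / 2 * (ζ + ε' / 2))) *
      jacobiTheta₂_term n (ζ + ε' / 2 + ε / 2 * τ) τ := by
  rw [jacobiTheta₂_term, ← Complex.exp_add]
  congr 1
  ring

/-- The series defining `theta` converges for `Im τ > 0`. -/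
theorem summable_theta (ε ε' : ℝ) (ζ τ : ℂ) (hτ : 0 < τ.im) :
    Summable fun n : ℤ => Complex.exp (2 * Real.pi * Complex.I *
      (1 / 2 * (n + ε / 2) ^ 2 * τ + (n + ε / 2) * (ζ + ε' / 2))) := by
  simp only [theta_term_eq]
  exact ((summable_jacobiTheta₂_term_iff _ τ).2 hτ).mul_left _

/-- For `Im τ > 0` the theta function is entire in `ζ`, so that `thetaDeriv` is its derivative. -/
theorem differentiable_theta (ε ε' : ℝ) (τ : ℂ) (hτ : 0 < τ.im) :
    Differentiable ℂ fun z : ℂ => theta ε ε' z τ := by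
  have h : (fun z : ℂ => theta ε ε' z τ) = fun z : ℂ =>
      Complex.exp (2 * Real.pi * Complex.I * (ε ^ 2 / 8 * τ + ε / 2 * (z + ε' / 2))) *
        jacobiTheta₂ (z + ε' / 2 + ε / 2 * τ) τ := by
    funext z
    simp only [theta, theta_term_eq, jacobiTheta₂]
    exact tsum_mul_left
  rw [h]
  intro z
  refine DifferentiableAt.mul (by fun_prop) ?_
  exact (differentiableAt_jacobiTheta₂_fst (z + ε' / 2 + ε / 2 * τ) hτ).comp z
    (f := fun z : ℂ => z + ε' / 2 + ε / 2 * τ) (by fun_prop)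

/-! The characteristic `ε'` only shifts `ζ`, so everything concerns `theta 0 0` and `theta 1 0` at
`0`, `1/4`, `1/2`. The addition formula `theta_mul_theta` writes the squares of the values at `1/4`,
and its derivative the products value times derivative there, through constants at `2τ`. What
remains is Jacobi's formula `thetaDeriv_one_half`: its quotient is invariant under `τ ↦ 2τ`, hence
equals its limit `-π` along `2 ^ k * τ`. Nonvanishing of the constants comes from the same doubling
and limit. -/

theorem theta_char_eq (ε ε' : ℝ) (ζ τ : ℂ) : theta ε ε' ζ τ = theta ε 0 (ζ + ε' / 2) τ := by
  simp [theta]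

theorem thetaDeriv_char_eq (ε ε' : ℝ) (ζ τ : ℂ) :
    thetaDeriv ε ε' ζ τ = thetaDeriv ε 0 (ζ + ε' / 2) τ := by
  simp only [thetaDeriv, theta_char_eq ε ε']
  exact deriv_comp_add_const (fun z => theta ε 0 z τ) (ε' / 2 : ℂ) ζ

theorem hasDerivAt_theta (ε : ℝ) (ζ : ℂ) {τ : ℂ} (hτ : 0 < τ.im) :
    HasDerivAt (fun z => theta ε 0 z τ) (thetaDeriv ε 0 ζ τ) ζ :=
  (differentiable_theta ε 0 τ hτ ζ).hasDerivAt

theorem theta_eq_mul_jacobiTheta₂ (ε : ℝ) (z τ : ℂ) :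
    theta ε 0 z τ = Complex.exp (2 * Real.pi * Complex.I * (ε ^ 2 / 8 * τ + ε / 2 * z)) *
      jacobiTheta₂ (z + ε / 2 * τ) τ := by
  simp only [theta, theta_term_eq, jacobiTheta₂, tsum_mul_left]
  simp

theorem theta_add_two (ε : ℝ) (z τ : ℂ) : theta (ε + 2) 0 z τ = theta ε 0 z τ := by
  unfold theta
  rw [← (Equiv.addRight (1 : ℤ)).tsum_eq (fun n : ℤ => Complex.exp (2 * Real.pi * Complex.I *
    (1 / 2 * (n + (ε : ℂ) / 2) ^ 2 * τ + (n + (ε : ℂ) / 2) * (z + (0 : ℝ) / 2))))]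
  refine tsum_congr fun n => ?_
  congr 1
  simp only [Equiv.coe_addRight]
  push_cast
  ring

theorem theta_neg (ε : ℝ) (z τ : ℂ) : theta (-ε) 0 (-z) τ = theta ε 0 z τ := by
  unfold theta
  rw [← (Equiv.neg ℤ).tsum_eq (fun n : ℤ => Complex.exp (2 * Real.pi * Complex.I *
    (1 / 2 * (n + (ε : ℂ) / 2) ^ 2 * τ + (n + (ε : ℂ) / 2) * (z + (0 : ℝ) / 2))))]
  refine tsum_congr fun n => ?_
  congr 1
  simp only [Equiv.neg_apply]
  push_cast
  ring

theorem theta_add_one (ε : ℝ) (z τ : ℂ) :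
    theta ε 0 (z + 1) τ = Complex.exp (Real.pi * Complex.I * ε) * theta ε 0 z τ := by
  unfold theta
  rw [← tsum_mul_left]
  refine tsum_congr fun n => ?_
  rw [← Complex.exp_add, Complex.exp_eq_exp_iff_exists_int]
  refine ⟨n, ?_⟩
  push_cast
  ring

/-! ### Addition formula -/

/-- Pairs of integers, split according to the parity of their sum. -/
def intProdParityEquiv : (ℤ × ℤ) ⊕ (ℤ × ℤ) ≃ ℤ × ℤ where
  toFun := Sum.elim (fun p => (p.1 + p.2, p.1 - p.2)) (fun p => (p.1 + p.2 + 1, p.1 - p.2))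
  invFun p := if (p.1 + p.2) % 2 = 0 then Sum.inl ((p.1 + p.2) / 2, (p.1 - p.2) / 2)
    else Sum.inr ((p.1 + p.2) / 2, (p.1 - p.2) / 2)
  left_inv := by
    rintro (⟨a, b⟩ | ⟨a, b⟩)
    · have h : (a + b + (a - b)) % 2 = 0 := by omega
      simp only [Sum.elim_inl, h, if_true, Sum.inl.injEq, Prod.mk.injEq]
      omega
    · have h : ¬ (a + b + 1 + (a - b)) % 2 = 0 := by omega
      simp only [Sum.elim_inr, h, if_false, Sum.inr.injEq, Prod.mk.injEq]
      omega
  right_inv := by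
    rintro ⟨a, b⟩
    by_cases h : (a + b) % 2 = 0
    · simp only [h, if_true, Sum.elim_inl, Prod.mk.injEq]
      omega
    · simp only [h, if_false, Sum.elim_inr, Prod.mk.injEq]
      omega

/-- Since `(p + q)² + (p - q)² = 2 (p² + q²)`, this reindexing separates theta products into series
at `2τ`. -/
theorem tsum_mul_tsum_eq_add_parity {f g : ℤ → ℂ} (hf : Summable f) (hg : Summable g) :
    (∑' n, f n) * ∑' n, g n = ∑' p : ℤ × ℤ, f (p.1 + p.2) * g (p.1 - p.2) +
      ∑' p : ℤ × ℤ, f (p.1 + p.2 + 1) * g (p.1 - p.2) := by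
  have hs : Summable fun p : ℤ × ℤ => f p.1 * g p.2 :=
    summable_mul_of_summable_norm hf.norm hg.norm
  rw [tsum_mul_tsum_of_summable_norm hf.norm hg.norm, ← intProdParityEquiv.tsum_eq]
  have hs' := (intProdParityEquiv.summable_iff).2 hs
  exact Summable.tsum_sum (f := fun q => f (intProdParityEquiv q).1 * g (intProdParityEquiv q).2)
    (hs'.comp_injective Sum.inl_injective) (hs'.comp_injective Sum.inr_injective)

/-- The addition formula expressing a product of two theta functions at `τ` through theta functions
at `2τ`. -/
theorem theta_mul_theta (ε δ : ℝ) (x y : ℂ) {τ : ℂ} (hτ : 0 < τ.im) :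
    theta ε 0 x τ * theta δ 0 y τ =
      theta ((ε + δ) / 2) 0 (x + y) (2 * τ) * theta ((ε - δ) / 2) 0 (x - y) (2 * τ) +
      theta ((ε + δ) / 2 + 1) 0 (x + y) (2 * τ) *
        theta ((ε - δ) / 2 + 1) 0 (x - y) (2 * τ) := by
  have h2 : 0 < (2 * τ).im := by simpa using hτ
  have hs := fun (ε : ℝ) (z : ℂ) => (summable_theta ε 0 z (2 * τ) h2).norm
  simp only [theta]
  rw [tsum_mul_tsum_eq_add_parity (summable_theta ε 0 x τ hτ) (summable_theta δ 0 y τ hτ),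
    tsum_mul_tsum_of_summable_norm (hs _ _) (hs _ _),
    tsum_mul_tsum_of_summable_norm (hs _ _) (hs _ _)]
  congr 1 <;>
  · refine tsum_congr fun p => ?_
    rw [← Complex.exp_add, ← Complex.exp_add]
    congr 1
    push_cast
    ring

/-! ### Special values and derivatives -/

theorem theta_zero_neg (z τ : ℂ) : theta 0 0 (-z) τ = theta 0 0 z τ := by
  simpa using theta_neg 0 z τ

theorem theta_one_neg (z τ : ℂ) : theta 1 0 (-z) τ = theta 1 0 z τ := by
  rw [← theta_neg 1 z, ← theta_add_two (-1)]
  norm_num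

theorem theta_zero_add_one (z τ : ℂ) : theta 0 0 (z + 1) τ = theta 0 0 z τ := by
  simpa using theta_add_one 0 z τ

theorem theta_one_add_one (z τ : ℂ) : theta 1 0 (z + 1) τ = -theta 1 0 z τ := by
  simpa using theta_add_one 1 z τ

theorem theta_one_half (τ : ℂ) : theta 1 0 (1 / 2) τ = 0 := by
  have h := theta_one_add_one (-(1 / 2)) τ
  rw [theta_one_neg, show (-(1 / 2) + 1 : ℂ) = 1 / 2 by norm_num] at h
  exact self_eq_neg.mp h

theorem theta_zero_mul_theta_zero (x y : ℂ) {τ : ℂ} (hτ : 0 < τ.im) :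
    theta 0 0 x τ * theta 0 0 y τ = theta 0 0 (x + y) (2 * τ) * theta 0 0 (x - y) (2 * τ) +
      theta 1 0 (x + y) (2 * τ) * theta 1 0 (x - y) (2 * τ) := by
  simpa using theta_mul_theta 0 0 x y hτ

theorem theta_one_mul_theta_one (x y : ℂ) {τ : ℂ} (hτ : 0 < τ.im) :
    theta 1 0 x τ * theta 1 0 y τ = theta 1 0 (x + y) (2 * τ) * theta 0 0 (x - y) (2 * τ) +
      theta 0 0 (x + y) (2 * τ) * theta 1 0 (x - y) (2 * τ) := by
  have h := theta_mul_theta 1 1 x y hτ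
  have h2 := theta_add_two 0 (x + y) (2 * τ)
  norm_num at h h2
  rwa [h2] at h

theorem theta_one_zero_sq {τ : ℂ} (hτ : 0 < τ.im) :
    theta 1 0 0 τ ^ 2 = 2 * (theta 1 0 0 (2 * τ) * theta 0 0 0 (2 * τ)) := by
  have h := theta_one_mul_theta_one 0 0 hτ
  simp only [add_zero, sub_zero] at h
  linear_combination h

theorem theta_zero_zero_mul_theta_zero_half {τ : ℂ} (hτ : 0 < τ.im) :
    theta 0 0 0 τ * theta 0 0 (1 / 2) τ = theta 0 0 (1 / 2) (2 * τ) ^ 2 := by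
  have h := theta_zero_mul_theta_zero 0 (1 / 2) hτ
  simp only [zero_add, zero_sub, theta_zero_neg, theta_one_neg, theta_one_half] at h
  linear_combination h

theorem theta_one_quarter_sq {τ : ℂ} (hτ : 0 < τ.im) :
    theta 1 0 (1 / 4) τ ^ 2 = theta 0 0 (1 / 2) (2 * τ) * theta 1 0 0 (2 * τ) := by
  have h := theta_one_mul_theta_one (1 / 4) (1 / 4) hτ
  rw [show (1 / 4 + 1 / 4 : ℂ) = 1 / 2 by norm_num, sub_self, theta_one_half] at h
  linear_combination h

theorem theta_zero_quarter_sq {τ : ℂ} (hτ : 0 < τ.im) :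
    theta 0 0 (1 / 4) τ ^ 2 = theta 0 0 (1 / 2) (2 * τ) * theta 0 0 0 (2 * τ) := by
  have h := theta_zero_mul_theta_zero (1 / 4) (1 / 4) hτ
  rw [show (1 / 4 + 1 / 4 : ℂ) = 1 / 2 by norm_num, sub_self, theta_one_half] at h
  linear_combination h

theorem deriv_eq_zero_of_symm {f : ℂ → ℂ} {c : ℂ} (h : ∀ z, f (c + z) = f (c - z)) :
    deriv f c = 0 := by
  have h1 : deriv (fun z => f (c + z)) 0 = deriv f c := by
    simpa using deriv_comp_const_add f c 0
  have h2 : deriv (fun z => f (c - z)) 0 = -deriv f c := by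
    simpa using deriv_comp_const_sub f c 0
  rw [← funext h, h1] at h2
  exact self_eq_neg.mp h2

theorem thetaDeriv_zero_zero (τ : ℂ) : thetaDeriv 0 0 0 τ = 0 :=
  deriv_eq_zero_of_symm fun z => by simp [theta_zero_neg]

theorem thetaDeriv_one_zero (τ : ℂ) : thetaDeriv 1 0 0 τ = 0 :=
  deriv_eq_zero_of_symm fun z => by simp [theta_one_neg]

theorem thetaDeriv_zero_half (τ : ℂ) : thetaDeriv 0 0 (1 / 2) τ = 0 := by
  refine deriv_eq_zero_of_symm fun z => ?_
  rw [← theta_zero_neg, ← theta_zero_add_one]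
  congr 1
  ring

/-- Differentiate the addition formula for `x = z`, `y = z + 1/2` at `z = 0`; as `x - y` is
constant, only one factor varies. -/
theorem thetaDeriv_one_half_double {τ : ℂ} (hτ : 0 < τ.im) :
    theta 1 0 0 τ * thetaDeriv 1 0 (1 / 2) τ =
      2 * (thetaDeriv 1 0 (1 / 2) (2 * τ) * theta 0 0 (1 / 2) (2 * τ)) := by
  have h2 : 0 < (2 * τ).im := by simpa using hτ
  have hl : HasDerivAt (fun z : ℂ => theta 1 0 z τ * theta 1 0 (z + 1 / 2) τ)
      (thetaDeriv 1 0 0 τ * theta 1 0 (0 + 1 / 2) τ +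
        theta 1 0 0 τ * thetaDeriv 1 0 (0 + 1 / 2) τ) 0 :=
    (hasDerivAt_theta 1 0 hτ).mul ((hasDerivAt_theta 1 (0 + 1 / 2) hτ).comp_add_const 0 (1 / 2))
  have hr : HasDerivAt (fun z : ℂ => theta 1 0 (2 * z + 1 / 2) (2 * τ) *
      theta 0 0 (1 / 2) (2 * τ))
      (thetaDeriv 1 0 (2 * 0 + 1 / 2) (2 * τ) * (2 * 1) * theta 0 0 (1 / 2) (2 * τ)) 0 :=
    (((hasDerivAt_theta 1 (2 * 0 + 1 / 2) h2).comp (0 : ℂ)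
      (((hasDerivAt_id (0 : ℂ)).const_mul 2).add_const (1 / 2 : ℂ)))).mul_const _
  have he : (fun z : ℂ => theta 1 0 z τ * theta 1 0 (z + 1 / 2) τ) =
      fun z : ℂ => theta 1 0 (2 * z + 1 / 2) (2 * τ) * theta 0 0 (1 / 2) (2 * τ) := by
    funext z
    rw [theta_one_mul_theta_one _ _ hτ, show z + (z + 1 / 2) = 2 * z + 1 / 2 by ring,
      show z - (z + 1 / 2) = -(1 / 2) by ring, theta_one_neg, theta_zero_neg, theta_one_half,
      mul_zero, add_zero]
  rw [he] at hl
  have h := hl.unique hr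
  simp only [zero_add, mul_zero, theta_one_half] at h
  linear_combination h

/-- Differentiate the addition formula for `x = z + 1/4`, `y = 1/4` at `z = 0`. Three of the four
terms die: `theta 1 0` vanishes at `1/2`, and symmetry kills the other derivatives. -/
theorem thetaDeriv_one_quarter_mul {τ : ℂ} (hτ : 0 < τ.im) :
    thetaDeriv 1 0 (1 / 4) τ * theta 1 0 (1 / 4) τ =
      thetaDeriv 1 0 (1 / 2) (2 * τ) * theta 0 0 0 (2 * τ) := by
  have h2 : 0 < (2 * τ).im := by simpa using hτ
  have hl := ((hasDerivAt_theta 1 (0 + 1 / 4) hτ).comp_add_const 0 (1 / 4)).mul_const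
    (theta 1 0 (1 / 4) τ)
  have hr := (((hasDerivAt_theta 1 (0 + 1 / 2) h2).comp_add_const 0 (1 / 2)).mul
    (hasDerivAt_theta 0 0 h2)).add
    (((hasDerivAt_theta 0 (0 + 1 / 2) h2).comp_add_const 0 (1 / 2)).mul (hasDerivAt_theta 1 0 h2))
  have h := hl.unique (hr.congr_of_eventuallyEq (.of_forall fun z => by
    have := theta_one_mul_theta_one (z + 1 / 4) (1 / 4) hτ
    rw [add_sub_cancel_right, show z + 1 / 4 + 1 / 4 = z + 1 / 2 by ring] at this
    exact this))
  simp only [zero_add, theta_one_half, thetaDeriv_zero_half, thetaDeriv_one_zero] at h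
  linear_combination h

theorem thetaDeriv_zero_quarter_mul {τ : ℂ} (hτ : 0 < τ.im) :
    thetaDeriv 0 0 (1 / 4) τ * theta 0 0 (1 / 4) τ =
      thetaDeriv 1 0 (1 / 2) (2 * τ) * theta 1 0 0 (2 * τ) := by
  have h2 : 0 < (2 * τ).im := by simpa using hτ
  have hl := ((hasDerivAt_theta 0 (0 + 1 / 4) hτ).comp_add_const 0 (1 / 4)).mul_const
    (theta 0 0 (1 / 4) τ)
  have hr := (((hasDerivAt_theta 0 (0 + 1 / 2) h2).comp_add_const 0 (1 / 2)).mul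
    (hasDerivAt_theta 0 0 h2)).add
    (((hasDerivAt_theta 1 (0 + 1 / 2) h2).comp_add_const 0 (1 / 2)).mul (hasDerivAt_theta 1 0 h2))
  have h := hl.unique (hr.congr_of_eventuallyEq (.of_forall fun z => by
    have := theta_zero_mul_theta_zero (z + 1 / 4) (1 / 4) hτ
    rw [add_sub_cancel_right, show z + 1 / 4 + 1 / 4 = z + 1 / 2 by ring] at this
    exact this))
  simp only [zero_add, theta_one_half, thetaDeriv_zero_half, thetaDeriv_zero_zero] at h
  linear_combination h

/-! ### Limits along `2 ^ k * τ` -/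

theorem tendsto_tsum_mul_exp_two_pow {a : ℤ → ℂ} {m : ℤ → ℤ} (hm : ∀ n, 0 ≤ m n) {τ : ℂ}
    (hτ : 0 < τ.im)
    (hs : Summable fun n => a n * Complex.exp (Real.pi * Complex.I * m n * τ)) :
    Filter.Tendsto (fun k : ℕ => ∑' n, a n * Complex.exp (Real.pi * Complex.I * m n * (2 ^ k * τ)))
      Filter.atTop (nhds (∑' n, if m n = 0 then a n else 0)) := by
  have hn : ∀ (k n : _), ‖Complex.exp (Real.pi * Complex.I * m n * ((2 : ℂ) ^ k * τ))‖ =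
      Real.exp (-(Real.pi * m n * τ.im * 2 ^ k)) := by
    intro k n
    rw [Complex.norm_exp, show (Real.pi * Complex.I * m n * ((2 : ℂ) ^ k * τ) : ℂ) =
      ((Real.pi * m n * 2 ^ k : ℝ) : ℂ) * (Complex.I * τ) by push_cast; ring,
      Complex.re_ofReal_mul, Complex.I_mul_re]
    congr 1
    ring
  refine tendsto_tsum_of_dominated_convergence hs.norm (fun n => ?_) (.of_forall fun k n => ?_)
  · split_ifs with h
    · simp [h]
    · have hpos : 0 < Real.pi * m n * τ.im := by
        have : (0 : ℝ) < m n := by exact_mod_cast lt_of_le_of_ne (hm n) (Ne.symm h)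
        positivity
      rw [tendsto_zero_iff_norm_tendsto_zero]
      simp only [norm_mul, hn]
      rw [← mul_zero ‖a n‖]
      refine Filter.Tendsto.const_mul _ (Real.tendsto_exp_neg_atTop_nhds_zero.comp ?_)
      exact (tendsto_pow_atTop_atTop_of_one_lt one_lt_two).const_mul_atTop hpos
  · have h0 := hn 0 n
    simp only [pow_zero, one_mul, mul_one] at h0
    rw [norm_mul, norm_mul, hn, h0]
    have hpos : 0 ≤ Real.pi * m n * τ.im := by
      have : (0 : ℝ) ≤ m n := by exact_mod_cast hm n
      positivity
    refine mul_le_mul_of_nonneg_left (Real.exp_le_exp.2 (neg_le_neg ?_)) (norm_nonneg _)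
    exact le_mul_of_one_le_right hpos (one_le_pow₀ one_le_two)

theorem im_two_pow_mul_pos {τ : ℂ} (hτ : 0 < τ.im) (k : ℕ) : 0 < ((2 : ℂ) ^ k * τ).im := by
  rw [show ((2 : ℂ) ^ k * τ) = ((2 ^ k : ℝ) : ℂ) * τ by push_cast; rfl, Complex.im_ofReal_mul]
  positivity

theorem int_mul_add_one_nonneg (n : ℤ) : 0 ≤ n * (n + 1) := by
  rcases le_or_gt 0 n with h | h
  · positivity
  · nlinarith

theorem tsum_ite_mul_add_one (a : ℤ → ℂ) :
    (∑' n : ℤ, if n * (n + 1) = 0 then a n else 0) = a 0 + a (-1) := by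
  rw [tsum_eq_sum (s := {0, -1})]
  · simp
  · intro n hn
    rw [if_neg]
    intro h
    rcases mul_eq_zero.mp h with h | h
    · simp [h] at hn
    · simp [show n = -1 by omega] at hn

theorem tendsto_jacobiTheta₂_two_pow (z : ℂ) {τ : ℂ} (hτ : 0 < τ.im) :
    Filter.Tendsto (fun k : ℕ => jacobiTheta₂ z (2 ^ k * τ)) Filter.atTop (nhds 1) := by
  have hterm : ∀ n τ, jacobiTheta₂_term n z τ = Complex.exp (2 * Real.pi * Complex.I * n * z) *
      Complex.exp (Real.pi * Complex.I * (n ^ 2 : ℤ) * τ) := by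
    intro n τ
    rw [jacobiTheta₂_term, Complex.exp_add]
    push_cast
    rfl
  have hs := (summable_jacobiTheta₂_term_iff z τ).2 hτ
  simp only [hterm] at hs
  have h := tendsto_tsum_mul_exp_two_pow (fun n => sq_nonneg n) hτ hs
  simp only [jacobiTheta₂, hterm]
  convert h
  rw [tsum_eq_single 0]
  · simp
  · intro n hn
    simp [hn]

/-- The exponent `n (n + 1)` vanishes at both `n = 0` and `n = -1`, each contributing `1`. -/
theorem tendsto_jacobiTheta₂_half_period_two_pow {τ : ℂ} (hτ : 0 < τ.im) :
    Filter.Tendsto (fun k : ℕ => jacobiTheta₂ (2 ^ k * τ / 2) (2 ^ k * τ)) Filter.atTop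
      (nhds 2) := by
  have hterm : ∀ n τ, jacobiTheta₂_term n (τ / 2) τ = 1 *
      Complex.exp (Real.pi * Complex.I * (n * (n + 1) : ℤ) * τ) := by
    intro n τ
    rw [jacobiTheta₂_term, one_mul]
    congr 1
    push_cast
    ring
  have hs := (summable_jacobiTheta₂_term_iff (τ / 2) τ).2 hτ
  simp only [hterm] at hs
  have h := tendsto_tsum_mul_exp_two_pow int_mul_add_one_nonneg hτ hs
  rw [tsum_ite_mul_add_one] at h
  simp only [jacobiTheta₂, hterm]
  convert h
  norm_num

theorem tendsto_jacobiTheta₂'_half_period_two_pow {τ : ℂ} (hτ : 0 < τ.im) :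
    Filter.Tendsto (fun k : ℕ => jacobiTheta₂' (1 / 2 + 2 ^ k * τ / 2) (2 ^ k * τ)) Filter.atTop
      (nhds (2 * Real.pi * Complex.I)) := by
  have hterm : ∀ n τ, jacobiTheta₂'_term n (1 / 2 + τ / 2) τ =
      2 * Real.pi * Complex.I * n * Complex.exp (Real.pi * Complex.I * n) *
      Complex.exp (Real.pi * Complex.I * (n * (n + 1) : ℤ) * τ) := by
    intro n τ
    rw [jacobiTheta₂'_term, jacobiTheta₂_term, mul_assoc _ (Complex.exp _), ← Complex.exp_add]
    congr 2
    push_cast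
    ring
  have hs := (summable_jacobiTheta₂'_term_iff (1 / 2 + τ / 2) τ).2 hτ
  simp only [hterm] at hs
  have h := tendsto_tsum_mul_exp_two_pow int_mul_add_one_nonneg hτ hs
  rw [tsum_ite_mul_add_one] at h
  simp only [jacobiTheta₂', hterm]
  convert h
  simp [Complex.exp_neg]

theorem theta_one_zero_eq (τ : ℂ) : theta 1 0 0 τ =
    Complex.exp (Real.pi * Complex.I * τ / 4) * jacobiTheta₂ (τ / 2) τ := by
  rw [theta_eq_mul_jacobiTheta₂]
  congr 2
  · push_cast
    ring
  · push_cast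
    ring

theorem thetaDeriv_one_half_eq {τ : ℂ} (hτ : 0 < τ.im) : thetaDeriv 1 0 (1 / 2) τ =
    Complex.exp (Real.pi * Complex.I * τ / 4) *
      (Complex.I * jacobiTheta₂' (1 / 2 + τ / 2) τ) := by
  have hc : Complex.exp (2 * Real.pi * Complex.I *
      (((1 : ℝ) : ℂ) ^ 2 / 8 * τ + ((1 : ℝ) : ℂ) / 2 * (1 / 2))) =
      Complex.exp (Real.pi * Complex.I * τ / 4) * Complex.I := by
    -- The third `Complex.I` is the standalone factor on the right.
    nth_rewrite 3 [← Complex.exp_pi_div_two_mul_I]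
    rw [← Complex.exp_add]
    congr 1
    push_cast
    ring
  have hz := theta_one_half τ
  rw [theta_eq_mul_jacobiTheta₂] at hz
  have hz := (mul_eq_zero.mp hz).resolve_left (Complex.exp_ne_zero _)
  have he : DifferentiableAt ℂ (fun z : ℂ => Complex.exp (2 * Real.pi * Complex.I *
      (((1 : ℝ) : ℂ) ^ 2 / 8 * τ + ((1 : ℝ) : ℂ) / 2 * z))) (1 / 2) := by fun_prop
  have hj := (hasDerivAt_jacobiTheta₂_fst (1 / 2 + ((1 : ℝ) : ℂ) / 2 * τ) hτ).comp_add_const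
    (1 / 2) (((1 : ℝ) : ℂ) / 2 * τ)
  have h := he.hasDerivAt.mul hj
  rw [thetaDeriv, funext fun z => theta_eq_mul_jacobiTheta₂ 1 z τ]
  refine h.deriv.trans ?_
  rw [hz, mul_zero, zero_add, hc, mul_assoc]
  congr 3
  push_cast
  ring

/-! ### Jacobi's derivative formula -/

/-- The product of the three even theta constants. -/
noncomputable def thetaNullProd (τ : ℂ) : ℂ :=
  theta 0 0 0 τ * theta 0 0 (1 / 2) τ * theta 1 0 0 τ

theorem theta_zero_eq_jacobiTheta₂ (z τ : ℂ) : theta 0 0 z τ = jacobiTheta₂ z τ := by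
  simpa using theta_eq_mul_jacobiTheta₂ 0 z τ

theorem tendsto_thetaNullProd {τ : ℂ} (hτ : 0 < τ.im) :
    Filter.Tendsto (fun k : ℕ => jacobiTheta₂ 0 (2 ^ k * τ) * jacobiTheta₂ (1 / 2) (2 ^ k * τ) *
      jacobiTheta₂ (2 ^ k * τ / 2) (2 ^ k * τ)) Filter.atTop (nhds 2) := by
  simpa using ((tendsto_jacobiTheta₂_two_pow 0 hτ).mul
    (tendsto_jacobiTheta₂_two_pow (1 / 2) hτ)).mul (tendsto_jacobiTheta₂_half_period_two_pow hτ)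

theorem thetaNullProd_eq (τ : ℂ) : thetaNullProd τ = Complex.exp (Real.pi * Complex.I * τ / 4) *
    (jacobiTheta₂ 0 τ * jacobiTheta₂ (1 / 2) τ * jacobiTheta₂ (τ / 2) τ) := by
  rw [thetaNullProd, theta_one_zero_eq, theta_zero_eq_jacobiTheta₂, theta_zero_eq_jacobiTheta₂]
  ring

theorem thetaNullProd_ne_zero_of_double {τ : ℂ} (hτ : 0 < τ.im)
    (h : thetaNullProd (2 * τ) ≠ 0) : thetaNullProd τ ≠ 0 := by
  simp only [thetaNullProd, mul_ne_zero_iff] at h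
  obtain ⟨⟨h0, h1⟩, h2⟩ := h
  have e1 := theta_one_zero_sq hτ
  have e2 := theta_zero_zero_mul_theta_zero_half hτ
  rw [thetaNullProd, e2]
  refine mul_ne_zero (pow_ne_zero 2 h1) fun h => ?_
  simp [h, h0, h2] at e1

/-- Up to an exponential factor the product tends to `2` along `2 ^ k * τ`, so it is nonzero for
some `k`; halving descends to `τ`. -/
theorem thetaNullProd_ne_zero {τ : ℂ} (hτ : 0 < τ.im) : thetaNullProd τ ≠ 0 := by
  obtain ⟨k, hk⟩ := ((tendsto_thetaNullProd hτ).eventually_ne two_ne_zero).exists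
  have hk : thetaNullProd (2 ^ k * τ) ≠ 0 := by
    rw [thetaNullProd_eq]
    exact mul_ne_zero (Complex.exp_ne_zero _) hk
  induction k with
  | zero => simpa using hk
  | succ k ih =>
    have hk : thetaNullProd (2 ^ k * τ) ≠ 0 := by
      refine thetaNullProd_ne_zero_of_double (im_two_pow_mul_pos hτ k) ?_
      rwa [← mul_assoc, ← pow_succ']
    refine ih ?_ hk
    rw [thetaNullProd_eq] at hk
    exact right_ne_zero_of_mul hk

theorem thetaDeriv_div_thetaNullProd_double {τ : ℂ} (hτ : 0 < τ.im) :
    thetaDeriv 1 0 (1 / 2) (2 * τ) / thetaNullProd (2 * τ) =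
      thetaDeriv 1 0 (1 / 2) τ / thetaNullProd τ := by
  have h2 : 0 < (2 * τ).im := by simpa using hτ
  have hP := thetaNullProd_ne_zero hτ
  have hP2 := thetaNullProd_ne_zero h2
  have hB : theta 1 0 0 τ ≠ 0 := right_ne_zero_of_mul hP
  have e1 := theta_one_zero_sq hτ
  have e2 := theta_zero_zero_mul_theta_zero_half hτ
  have e3 := thetaDeriv_one_half_double hτ
  rw [div_eq_div_iff hP2 hP]
  -- The extra factor `theta 1 0 0 τ` makes `e3` applicable and completes the square in `e1`.
  apply mul_left_cancel₀ hB
  unfold thetaNullProd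
  rw [e2]
  linear_combination thetaDeriv 1 0 (1 / 2) (2 * τ) * theta 0 0 (1 / 2) (2 * τ) ^ 2 * e1 -
    theta 0 0 0 (2 * τ) * theta 0 0 (1 / 2) (2 * τ) * theta 1 0 0 (2 * τ) * e3

/-- Jacobi's derivative formula. -/
theorem thetaDeriv_one_half {τ : ℂ} (hτ : 0 < τ.im) :
    thetaDeriv 1 0 (1 / 2) τ = -Real.pi * thetaNullProd τ := by
  have hconst : ∀ k : ℕ, thetaDeriv 1 0 (1 / 2) (2 ^ k * τ) / thetaNullProd (2 ^ k * τ) =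
      thetaDeriv 1 0 (1 / 2) τ / thetaNullProd τ := by
    intro k
    induction k with
    | zero => simp
    | succ k ih =>
      rw [← ih, pow_succ', mul_assoc, thetaDeriv_div_thetaNullProd_double (im_two_pow_mul_pos hτ k)]
  have hlim := ((tendsto_jacobiTheta₂'_half_period_two_pow hτ).const_mul Complex.I).div
    (tendsto_thetaNullProd hτ) two_ne_zero
  have heq : ∀ k : ℕ, Complex.I * jacobiTheta₂' (1 / 2 + 2 ^ k * τ / 2) (2 ^ k * τ) /
      (jacobiTheta₂ 0 (2 ^ k * τ) * jacobiTheta₂ (1 / 2) (2 ^ k * τ) *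
        jacobiTheta₂ (2 ^ k * τ / 2) (2 ^ k * τ)) =
      thetaDeriv 1 0 (1 / 2) τ / thetaNullProd τ := by
    intro k
    rw [← hconst k, thetaDeriv_one_half_eq (im_two_pow_mul_pos hτ k), thetaNullProd_eq,
      mul_div_mul_left _ _ (Complex.exp_ne_zero _)]
  have h := tendsto_nhds_unique (tendsto_const_nhds.congr fun k => (heq k).symm) hlim
  rw [div_eq_iff (thetaNullProd_ne_zero hτ)] at h
  rw [h]
  linear_combination Real.pi * thetaNullProd τ * Complex.I_sq

theorem mainTheorem1 (τ : ℂ) (hτ : 0 < τ.im) :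
    (theta 1 (1 / 2) 0 τ ≠ 0 ∧
      thetaDeriv 1 (1 / 2) 0 τ =
        1 / 4 * (thetaDeriv 1 1 0 τ * theta 1 0 0 τ ^ 3 / theta 1 (1 / 2) 0 τ ^ 3) ∧
      1 / 4 * (thetaDeriv 1 1 0 τ * theta 1 0 0 τ ^ 3 / theta 1 (1 / 2) 0 τ ^ 3) =
        -Real.pi * theta 0 0 0 (2 * τ) ^ 2 * theta 1 (1 / 2) 0 τ) ∧
    (theta 0 (1 / 2) 0 τ ≠ 0 ∧
      thetaDeriv 0 (1 / 2) 0 τ =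
        1 / 4 * (thetaDeriv 1 1 0 τ * theta 1 0 0 τ ^ 3 / theta 0 (1 / 2) 0 τ ^ 3) ∧
      1 / 4 * (thetaDeriv 1 1 0 τ * theta 1 0 0 τ ^ 3 / theta 0 (1 / 2) 0 τ ^ 3) =
        -Real.pi * theta 1 0 0 (2 * τ) ^ 2 * theta 0 (1 / 2) 0 τ) := by
  have h2 : 0 < (2 * τ).im := by simpa using hτ
  have hz : (0 : ℂ) + ((1 / 2 : ℝ) : ℂ) / 2 = 1 / 4 := by norm_num
  have hz' : (0 : ℂ) + ((1 : ℝ) : ℂ) / 2 = 1 / 2 := by norm_num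
  rw [theta_char_eq 1 (1 / 2), theta_char_eq 0 (1 / 2), thetaDeriv_char_eq 1 (1 / 2),
    thetaDeriv_char_eq 0 (1 / 2), thetaDeriv_char_eq 1 1, hz, hz']
  have hD := thetaDeriv_one_half hτ
  have hP2 := thetaNullProd_ne_zero h2
  have hD2 := thetaDeriv_one_half h2
  unfold thetaNullProd at hD hP2 hD2
  have e1 := theta_one_zero_sq hτ
  have e2 := theta_zero_zero_mul_theta_zero_half hτ
  have q1 := theta_one_quarter_sq hτ
  have q0 := theta_zero_quarter_sq hτ
  have d1 := thetaDeriv_one_quarter_mul hτ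
  have d0 := thetaDeriv_zero_quarter_mul hτ
  rw [hD2] at d1 d0
  -- Jacobi's formula supplies a fourth factor `theta 1 0 0 τ`; the square of `e1` then gives the
  -- `4` that cancels `1 / 4`.
  have hnum : thetaDeriv 1 0 (1 / 2) τ * theta 1 0 0 τ ^ 3 = -Real.pi * 4 *
      (theta 0 0 0 (2 * τ) * theta 0 0 (1 / 2) (2 * τ) * theta 1 0 0 (2 * τ)) ^ 2 := by
    rw [hD, e2]
    linear_combination -Real.pi * theta 0 0 (1 / 2) (2 * τ) ^ 2 * (theta 1 0 0 τ ^ 2 +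
      2 * (theta 1 0 0 (2 * τ) * theta 0 0 0 (2 * τ))) * e1
  rw [hnum]
  generalize theta 0 0 0 (2 * τ) = a at *
  generalize theta 0 0 (1 / 2) (2 * τ) = c at *
  generalize theta 1 0 0 (2 * τ) = b at *
  generalize theta 1 0 (1 / 4) τ = f at *
  generalize theta 0 0 (1 / 4) τ = g at *
  simp only [mul_ne_zero_iff] at hP2
  obtain ⟨⟨ha, hc⟩, hb⟩ := hP2
  have hf : f ≠ 0 := by
    rintro rfl
    simp [hc, hb] at q1
  have hg : g ≠ 0 := by
    rintro rfl
    simp [hc, ha] at q0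
  have hf4 : f ^ 4 = (c * b) ^ 2 := by rw [← q1]; ring
  have hg4 : g ^ 4 = (c * a) ^ 2 := by rw [← q0]; ring
  have r1 : 1 / 4 * (-Real.pi * 4 * (a * c * b) ^ 2 / f ^ 3) = -Real.pi * a ^ 2 * f := by
    field_simp
    linear_combination hf4
  have r0 : 1 / 4 * (-Real.pi * 4 * (a * c * b) ^ 2 / g ^ 3) = -Real.pi * b ^ 2 * g := by
    field_simp
    linear_combination hg4
  refine ⟨⟨hf, ?_, r1⟩, hg, ?_, r0⟩
  · rw [r1]
    apply mul_right_cancel₀ hf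
    linear_combination d1 + Real.pi * a ^ 2 * q1
  · rw [r0]
    apply mul_right_cancel₀ hg
    linear_combination d0 + Real.pi * b ^ 2 * q0
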